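/- Let $S^2\subset\mathbb R^3$ be the round unit sphere with its surface measure, $\|\cdot\|_p$ the norm of $L^p(S^2)$, $\langle f,g\rangle=\int_{S^2}f\overline g$, and let $\mathcal{SH}_k$ be the space of (complex) spherical harmonics of degree $k$, i.e. the restrictions to $S^2$ of the harmonic polynomials that are homogeneous of degree $k$. Let $Q_k=c_k(x_1+ix_2)^k\in\mathcal{SH}_k$, $c_k>0$, $\|Q_k\|_2=1$, be the standard Gaussian beam, with the north pole as its pole. A Gaussian beam of degree $k$ with pole $x\in S^2$ is a function $Q_k\circ R$, where $R\in SO(3)$ takes $x$ to the north pole. Put $\sigma(p)=\frac12\left(\frac12-\frac1p\right)$. There are constants $C_p>0$ $(2<p\le 6)$ such that $\|Q_k\|_p/k^{\sigma(p)}\to C_p$ as $k\to\infty$ for every $2<p\le6$, and the following holds. Let $D>0$ satisfy $$(7+1296D)\,e^{-1/(72D)}\le\frac1{25};$$ $D=1/400$ is such a number. Then $D<1$, and there is a $k_0$ such that for all integers $k\ge k_0$, with $m=\lfloor D(2k+1)\rfloor$, there is an orthonormal set $\{u_i\}_{i=1}^m\subset\mathcal{SH}_k$ with $$\|u_i\|_p\ge\tfrac12\|Q_k\|_p\quad\text{and}\quad\|u_i\|_p\ge\tfrac12C_pk^{\sigma(p)}\qquad\text{for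 all } 1\le i\le m\text{ and all }2<p\le6.$$ Moreover, the $u_i$ can be taken of the form $u_i=\sum_{j=1}^mF_{ij}q_j$, where $q_1,\dots,q_m$ are Gaussian beams of degree $k$ whose poles $x_1,\dots,x_m$ are at pairwise angles at least $1/\sqrt m$, their Gram matrix $E=(\langle q_i,q_j\rangle)_{i,j}$ is positive definite, and $F=E^{-1/2}$ is the positive definite square root of $E^{-1}$. -/

import Mathlib

open MeasureTheory Filter Topology
open scoped ComplexConjugate ComplexOrder

noncomputable section

namespace SphHarm

/-- Euclidean three-space. -/
abbrev E3 : Type := EuclideanSpace ℝ (Fin 3)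

/-- The unit sphere in Euclidean three-space. -/
abbrev S2 : Type := Metric.sphere (0 : E3) 1

/-- The surface measure of the round unit sphere (of total mass `4 * π`). -/
def surf : Measure S2 := (volume : Measure E3).toSphere

instance : IsFiniteMeasure surf := inferInstanceAs (IsFiniteMeasure (Measure.toSphere _))

/-- The `L^p` norm of a continuous function on the sphere, for a real exponent `p`. -/
def normLp (p : ℝ) (f : C(S2, ℂ)) : ℝ := lpNorm f (ENNReal.ofReal p) surf

/-- The `L^2` inner product `∫ f * conj g`. -/
def innerL2 (f g : C(S2, ℂ)) : ℂ := ∫ x, f x * conj (g x) ∂surf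

/-- The restriction to the sphere of a polynomial in three variables, as a linear map. -/
def restrict : MvPolynomial (Fin 3) ℂ →ₗ[ℂ] C(S2, ℂ) :=
  (MvPolynomial.aeval fun i : Fin 3 =>
    (⟨fun x : S2 => (((x : E3) i : ℝ) : ℂ), by fun_prop⟩ : C(S2, ℂ))).toLinearMap

/-- The Laplacian of a polynomial in three variables. -/
def laplacian : MvPolynomial (Fin 3) ℂ →ₗ[ℂ] MvPolynomial (Fin 3) ℂ :=
  ∑ i : Fin 3, (MvPolynomial.pderiv i).toLinearMap ∘ₗ (MvPolynomial.pderiv i).toLinearMap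

/-- The spherical harmonics of degree `k`: the restrictions to the sphere of the harmonic
polynomials which are homogeneous of degree `k`. -/
def sphericalHarmonics (k : ℕ) : Submodule ℂ C(S2, ℂ) :=
  (MvPolynomial.homogeneousSubmodule (Fin 3) ℂ k ⊓ LinearMap.ker laplacian).map restrict

/-- The function `(x₁ + i x₂) ^ k` on the sphere. In the coordinates
`(sin φ cos θ, sin φ sin θ, cos φ)` it is `(sin φ) ^ k * exp (i k θ)`, a nonzero constant multiple
of `P_k^k (cos φ) * exp (i k θ)`, with `P_k^k` the associated Legendre function. -/
def sectoral (k : ℕ) : C(S2, ℂ) :=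
  ⟨fun x => ((((x : E3) 0 : ℝ) : ℂ) + Complex.I * (((x : E3) 1 : ℝ) : ℂ)) ^ k, by fun_prop⟩

/-- The standard Gaussian beam `Q_k` (the sectoral harmonic), of `L^2` norm one. Its pole is the
north pole. -/
def gaussianBeam (k : ℕ) : C(S2, ℂ) := ((normLp 2 (sectoral k) : ℂ)⁻¹) • sectoral k

/-- The action of a linear isometry on the sphere. -/
def rotate (R : E3 ≃ₗᵢ[ℝ] E3) (y : S2) : S2 :=
  ⟨R y, by simp⟩

/-- `q` is a Gaussian beam of degree `k` with pole `x`: it is `Q_k ∘ R` for a rotation `R` that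
takes `x` to the north pole. (For `k ≥ 1` the rotations about the axis through `x` produce all
the phase factors.) -/
def IsGaussianBeam (k : ℕ) (x : S2) (q : C(S2, ℂ)) : Prop :=
  ∃ R : E3 ≃ₗᵢ[ℝ] E3, LinearMap.det (R.toLinearEquiv : E3 →ₗ[ℝ] E3) = 1 ∧
    R x = EuclideanSpace.single 2 1 ∧ ∀ y : S2, q y = gaussianBeam k (rotate R y)

/-- The Gram matrix with entries `⟨q i, q j⟩ = ∫ q i * conj (q j)`. -/
def gramMatrix {m : ℕ} (q : Fin m → C(S2, ℂ)) : Matrix (Fin m) (Fin m) ℂ :=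
  Matrix.of fun i j => innerL2 (q i) (q j)

/-- `F = E ^ (-1/2)`: `F` is the positive definite Hermitian square root of the inverse of the
positive definite matrix `E`. -/
def IsInvSqrt {m : ℕ} (E F : Matrix (Fin m) (Fin m) ℂ) : Prop :=
  E.PosDef ∧ F.PosDef ∧ F * F = E⁻¹

/-- The exponent `σ(p) = (1/2) (1/2 - 1/p)` of the sphere in the range `2 < p ≤ 6`. -/
def sigma (p : ℝ) : ℝ := (1 / 2) * (1 / 2 - 1 / p)

/-- The explicit condition on the density. -/
def DensityCondition (D : ℝ) : Prop :=
  (7 + 1296 * D) * Real.exp (-1 / (72 * D)) ≤ 1 / 25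

end SphHarm

end

/-!
The family `u` is the symmetric (Löwdin) orthonormalization of `m` Gaussian beams whose poles are
so far apart that the beams are almost orthogonal.

*Overlaps.* Gaussian beams are coherent states: `|⟨q, q'⟩| = ((1 + ⟪x, x'⟫) / 2) ^ k` for beams with
poles `x`, `x'` (`norm_innerL2_isGaussianBeam`). After a rotation `q` is a multiple of `z ^ k` with
`z = x₁ + i x₂`, and `q'` is a multiple of the `k`-th power of a linear form. Invariance under
rotations about the axis kills every monomial except `z ^ k` (`integral_planar_pow_mul_linear_pow`),
and the coefficient of `z` in the linear form is found from the cofactor identity for rotation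
matrices. Since `(1 + ⟪x, x'⟫) / 2 = 1 - |x - x'|² / 4`, the overlap is at most
`exp (-k |x - x'|² / 4)`.

*Poles.* The points of a square grid of mesh `1 / √m` in the unit disc are lifted to the upper
hemisphere, which does not decrease distances. The density condition forces `D < 1 / 288`, so that
`20 * m ≤ k` and the overlap of two beams at grid distance `d` is at most `exp (-5) ^ d`. A geometric
series bounds the absolute row sums of `E - 1`, with `E` the Gram matrix, by `1 / 5`
(`exists_almost_orthonormal_beams`).

*Orthonormalization.* The row-sum norm is submultiplicative, and `F = E ^ (-1/2)` is obtained by a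
contraction argument together with `‖F - 1‖ ≤ 1 / 4` (`exists_isInvSqrt`). Hence `u i` differs from
`q i` by at most `‖Q_k‖_p / 4` in `L^p`, and `‖u i‖_p ≥ (3 / 4) ‖Q_k‖_p`.

*Asymptotics.* The Gaussian integral gives
`∫ |z| ^ s = 2 π ^ (3/2) Γ(s/2 + 1) / Γ(s/2 + 3/2)` over the sphere, and log-convexity of `Γ` yields
`k / (k + 1) ≤ ‖Q_k‖_p / (C_p k ^ σ(p)) ≤ (k + 1) / k` with an explicit `C_p`
(`normLp_gaussianBeam_bounds`). These bounds are uniform in `p`, and they provide both the limit and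
the second lower bound for `‖u i‖_p`, as `(3 / 4) * (2 / 3) = 1 / 2`.
-/

namespace SphHarm

/-! ### Matrices close to the identity in the row-sum norm -/

section RowSumNorm

open scoped Matrix.Norms.Operator

variable {n : Type*} [Fintype n] [DecidableEq n]

/-- The eigenvalues lie within `‖A - 1‖` of `1`, as for any submultiplicative norm. -/
theorem posDef_of_norm_sub_one_lt {A : Matrix n n ℂ} (hA : A.IsHermitian) (h : ‖A - 1‖ < 1) :
    A.PosDef := by
  rw [hA.posDef_iff_eigenvalues_pos]
  intro i
  set v : n → ℂ := (hA.eigenvectorBasis i).ofLp with hv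
  have hv0 : v ≠ 0 := by
    intro h0
    have : hA.eigenvectorBasis i = 0 := by
      ext j
      simpa [hv] using congrFun h0 j
    exact hA.eigenvectorBasis.orthonormal.ne_zero i this
  have h1 : (A - 1).mulVec v = ((hA.eigenvalues i - 1 : ℝ) : ℂ) • v := by
    rw [Matrix.sub_mulVec, hA.mulVec_eigenvectorBasis i, Matrix.one_mulVec]
    ext j
    simp [hv, sub_mul]
  have h2 := Matrix.linfty_opNorm_mulVec (A - 1) v
  rw [h1, norm_smul, Complex.norm_real, Real.norm_eq_abs] at h2
  have h3 : |hA.eigenvalues i - 1| ≤ ‖A - 1‖ := le_of_mul_le_mul_right h2 (norm_pos_iff.2 hv0)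
  linarith [(abs_le.1 h3).1]

/-- A Hermitian matrix that is close to `1` in the row-sum norm has a Hermitian square root that is
close to `1` in the same norm: with `F = 1 + Y`, the equation `F * F = B` says that `Y` is a fixed
point of the contraction `Y ↦ (B - 1 - Y * Y) / 2`. -/
theorem exists_isHermitian_mul_self_eq {B : Matrix n n ℂ} (hB : B.IsHermitian)
    (h : ‖B - 1‖ ≤ 1 / 4) :
    ∃ F : Matrix n n ℂ, F.IsHermitian ∧ F * F = B ∧ ‖F - 1‖ ≤ 1 / 4 := by
  let T : Matrix n n ℂ → Matrix n n ℂ := fun Y => (2⁻¹ : ℝ) • (B - 1 - Y * Y)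
  let s : Set (Matrix n n ℂ) := {Y | Y.IsHermitian ∧ ‖Y‖ ≤ 1 / 4}
  have hs : IsComplete s := by
    have : CompleteSpace (Matrix n n ℂ) := FiniteDimensional.complete ℂ _
    refine IsClosed.isComplete (IsClosed.inter ?_ ?_)
    · exact isClosed_eq (continuous_id.matrix_conjTranspose) continuous_id
    · exact isClosed_le continuous_norm continuous_const
  have hT : Set.MapsTo T s s := by
    rintro Y ⟨hY, hY'⟩
    constructor
    · have h1 : (Y * Y).IsHermitian := by
        rw [Matrix.IsHermitian, Matrix.conjTranspose_mul, hY]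
      have h2 := (hB.sub Matrix.isHermitian_one).sub h1
      rw [Matrix.IsHermitian] at h2 ⊢
      simp only [T]
      rw [Matrix.conjTranspose_smul, h2]
      simp
    · have h1 : ‖Y * Y‖ ≤ 1 / 4 * (1 / 4) := (norm_mul_le _ _).trans (by gcongr)
      have h2 := norm_sub_le (B - 1) (Y * Y)
      simp only [T]
      rw [norm_smul, Real.norm_eq_abs, abs_of_pos (by norm_num)]
      linarith
  have hc : ContractingWith (1 / 4) (hT.restrict T s s) := by
    refine ⟨by rw [← NNReal.coe_lt_coe]; norm_num, LipschitzWith.of_dist_le_mul ?_⟩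
    rintro ⟨Y, hY, hY'⟩ ⟨Z, hZ, hZ'⟩
    rw [Subtype.dist_eq, Subtype.dist_eq]
    simp only [Set.MapsTo.val_restrict_apply, T, dist_eq_norm]
    have e : (2⁻¹ : ℝ) • (B - 1 - Y * Y) - (2⁻¹ : ℝ) • (B - 1 - Z * Z)
        = (2⁻¹ : ℝ) • ((Z - Y) * Z + Y * (Z - Y)) := by
      rw [← smul_sub]; congr 1; noncomm_ring
    rw [e, norm_smul, Real.norm_eq_abs, abs_of_pos (by norm_num)]
    have h1 : ‖(Z - Y) * Z‖ ≤ ‖Y - Z‖ * (1 / 4) := by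
      rw [norm_sub_rev Y]; exact (norm_mul_le _ _).trans (by gcongr)
    have h2 : ‖Y * (Z - Y)‖ ≤ 1 / 4 * ‖Y - Z‖ := by
      rw [norm_sub_rev Y]; exact (norm_mul_le _ _).trans (by gcongr)
    have h3 := norm_add_le ((Z - Y) * Z) (Y * (Z - Y))
    push_cast
    linarith
  obtain ⟨Y, ⟨hY, hY'⟩, hfix, -⟩ := hc.exists_fixedPoint' hs hT (x := 0)
    ⟨Matrix.isHermitian_zero, by simp⟩ (edist_ne_top _ _)
  refine ⟨1 + Y, Matrix.isHermitian_one.add hY, ?_, by simpa using hY'⟩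
  have h1 : (2⁻¹ : ℝ) • (B - 1 - Y * Y) = Y := hfix
  have h2 : B - 1 - Y * Y = (2 : ℝ) • Y := by
    conv_rhs => rw [← h1]
    rw [smul_smul]; norm_num
  rw [two_smul] at h2
  have h3 : B = 1 + Y * Y + (Y + Y) := by rw [← h2]; abel
  rw [h3]; noncomm_ring

/-- From `E⁻¹ - 1 = -(E⁻¹ - 1) * (E - 1) - (E - 1)`. -/
theorem norm_inv_sub_one_le {E : Matrix n n ℂ} (hE : IsUnit E) (h : ‖E - 1‖ ≤ 1 / 5) :
    ‖E⁻¹ - 1‖ ≤ 1 / 4 := by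
  have h1 : E⁻¹ * E = 1 := Matrix.nonsing_inv_mul _ ((Matrix.isUnit_iff_isUnit_det _).1 hE)
  have h2 : E⁻¹ - 1 = -((E⁻¹ - 1) * (E - 1)) - (E - 1) := by
    have : (E⁻¹ - 1) * (E - 1) = E⁻¹ * E - E⁻¹ - E + 1 := by noncomm_ring
    rw [this, h1]; abel
  have h3 := norm_sub_le (-((E⁻¹ - 1) * (E - 1))) (E - 1)
  rw [← h2, norm_neg] at h3
  have h4 : ‖(E⁻¹ - 1) * (E - 1)‖ ≤ ‖E⁻¹ - 1‖ * (1 / 5) := (norm_mul_le _ _).trans (by gcongr)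
  linarith

theorem norm_le_of_sum_norm_le {A : Matrix n n ℂ} {r : ℝ} (hr : 0 ≤ r)
    (h : ∀ i, ∑ j, ‖A i j‖ ≤ r) : ‖A‖ ≤ r := by
  lift r to NNReal using hr
  rw [← coe_nnnorm, NNReal.coe_le_coe, Matrix.linfty_opNNNorm_def]
  refine Finset.sup_le fun i _ => ?_
  rw [← NNReal.coe_le_coe]
  simpa using h i

theorem sum_norm_le_norm (A : Matrix n n ℂ) (i : n) : ∑ j, ‖A i j‖ ≤ ‖A‖ := by
  have h : ∑ j, ‖A i j‖₊ ≤ ‖A‖₊ := by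
    rw [Matrix.linfty_opNNNorm_def]
    exact Finset.le_sup (f := fun i => ∑ j, ‖A i j‖₊) (Finset.mem_univ i)
  have := NNReal.coe_le_coe.2 h
  simpa using this

end RowSumNorm

/-- A Gram matrix whose rows of `E - 1` have small absolute sums has an inverse square root with
the same property. -/
theorem exists_isInvSqrt {m : ℕ} {E : Matrix (Fin m) (Fin m) ℂ} (hE : E.IsHermitian)
    (h : ∀ i, ∑ j, ‖(E - 1) i j‖ ≤ 1 / 5) :
    ∃ F, IsInvSqrt E F ∧ ∀ i, ∑ j, ‖(F - 1) i j‖ ≤ 1 / 4 := by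
  open scoped Matrix.Norms.Operator in
  have h1 : ‖E - 1‖ ≤ 1 / 5 := norm_le_of_sum_norm_le (by norm_num) h
  have hpos : E.PosDef := posDef_of_norm_sub_one_lt hE (by linarith)
  have h2 := norm_inv_sub_one_le hpos.isUnit h1
  obtain ⟨F, hF, hFF, hF1⟩ := exists_isHermitian_mul_self_eq hE.inv h2
  exact ⟨F, ⟨hpos, posDef_of_norm_sub_one_lt hF (by linarith), hFF⟩,
    fun i => (sum_norm_le_norm _ i).trans hF1⟩

theorem IsInvSqrt.mul_mul_eq_one {m : ℕ} {E F : Matrix (Fin m) (Fin m) ℂ} (h : IsInvSqrt E F) :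
    F * E * F = 1 := by
  obtain ⟨hE, hF, hFF⟩ := h
  have hu : IsUnit E.det := (Matrix.isUnit_iff_isUnit_det _).1 hE.isUnit
  have h1 : F * (F * E) = 1 := by rw [← mul_assoc, hFF, Matrix.nonsing_inv_mul _ hu]
  exact mul_eq_one_comm.1 h1

/-! ### Rotation invariance -/

theorem continuous_rotate (R : E3 ≃ₗᵢ[ℝ] E3) : Continuous (rotate R) :=
  Continuous.subtype_mk (R.continuous.comp continuous_subtype_val) _

@[simp] theorem coe_rotate (R : E3 ≃ₗᵢ[ℝ] E3) (y : S2) : (rotate R y : E3) = R y := rfl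

/-- Composition of a continuous function on the sphere with a linear isometry. -/
noncomputable def compRotate (f : C(S2, ℂ)) (R : E3 ≃ₗᵢ[ℝ] E3) : C(S2, ℂ) :=
  f.comp ⟨rotate R, continuous_rotate R⟩

@[simp] theorem compRotate_apply (f : C(S2, ℂ)) (R : E3 ≃ₗᵢ[ℝ] E3) (y : S2) :
    compRotate f R y = f (rotate R y) := rfl

theorem rotate_symm_rotate (R : E3 ≃ₗᵢ[ℝ] E3) (y : S2) : rotate R.symm (rotate R y) = y :=
  Subtype.ext (by simp)

open scoped Pointwise in
theorem measurePreserving_rotate (R : E3 ≃ₗᵢ[ℝ] E3) :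
    MeasurePreserving (rotate R) surf surf := by
  refine ⟨(continuous_rotate R).measurable, Measure.ext fun s hs => ?_⟩
  rw [Measure.map_apply (continuous_rotate R).measurable hs, surf,
    Measure.toSphere_apply' _ ((continuous_rotate R).measurable hs), Measure.toSphere_apply' _ hs]
  congr 1
  rw [← R.measurePreserving.measure_preimage_emb R.toHomeomorph.measurableEmbedding
    (Set.Ioo (0 : ℝ) 1 • (Subtype.val '' s : Set E3))]
  congr 1
  ext v
  simp only [Set.mem_smul, Set.mem_image, Set.mem_preimage]
  constructor
  · rintro ⟨t, ht, -, ⟨y, hy, rfl⟩, rfl⟩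
    exact ⟨t, ht, _, ⟨_, hy, rfl⟩, by simp⟩
  · rintro ⟨t, ht, -, ⟨y, hy, rfl⟩, h⟩
    refine ⟨t, ht, _, ⟨rotate R.symm y, ?_, rfl⟩, ?_⟩
    · have : rotate R (rotate R.symm y) = y := rotate_symm_rotate R.symm y
      rwa [this]
    · rw [coe_rotate, ← map_smul, h]; simp

theorem measurableEmbedding_rotate (R : E3 ≃ₗᵢ[ℝ] E3) : MeasurableEmbedding (rotate R) :=
  Topology.IsClosedEmbedding.measurableEmbedding <|
    ((continuous_rotate R).isClosedEmbedding
      (Function.LeftInverse.injective (rotate_symm_rotate R)))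

theorem innerL2_compRotate (f g : C(S2, ℂ)) (R : E3 ≃ₗᵢ[ℝ] E3) :
    innerL2 (compRotate f R) (compRotate g R) = innerL2 f g :=
  (measurePreserving_rotate R).integral_comp (measurableEmbedding_rotate R)
    (fun x => f x * conj (g x))

theorem IsGaussianBeam.exists_eq_compRotate {k : ℕ} {x : S2} {q : C(S2, ℂ)}
    (h : IsGaussianBeam k x q) : ∃ R : E3 ≃ₗᵢ[ℝ] E3, q = compRotate (gaussianBeam k) R := by
  obtain ⟨R, -, -, hR⟩ := h
  exact ⟨R, ContinuousMap.ext hR⟩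

/-! ### The `L^p` norm and the inner product -/

theorem memLp_continuousMap (f : C(S2, ℂ)) (p : ENNReal) : MemLp f p surf := by
  refine MemLp.of_bound f.continuous.aestronglyMeasurable ‖f‖ (ae_of_all _ f.norm_coe_le_norm)

theorem integrable_continuousMap (f : C(S2, ℂ)) : Integrable f surf :=
  memLp_one_iff_integrable.1 (memLp_continuousMap f 1)

theorem normLp_nonneg (p : ℝ) (f : C(S2, ℂ)) : 0 ≤ normLp p f := lpNorm_nonneg

theorem normLp_eq {p : ℝ} (hp : 0 < p) (f : C(S2, ℂ)) :
    normLp p f = (∫ x, ‖f x‖ ^ p ∂surf) ^ p⁻¹ := by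
  rw [normLp, lpNorm_eq_integral_norm_rpow_toReal (by simpa using hp) ENNReal.ofReal_ne_top
    f.continuous.aestronglyMeasurable, ENNReal.toReal_ofReal hp.le]

theorem normLp_smul (p : ℝ) (c : ℂ) (f : C(S2, ℂ)) : normLp p (c • f) = ‖c‖ * normLp p f := by
  rw [normLp, ContinuousMap.coe_smul, lpNorm_const_smul]; simp [normLp]

theorem normLp_add_le {p : ℝ} (hp : 1 ≤ p) (f g : C(S2, ℂ)) :
    normLp p (f + g) ≤ normLp p f + normLp p g := by
  rw [normLp, ContinuousMap.coe_add]
  exact lpNorm_add_le (memLp_continuousMap f _) (by simpa using hp)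

theorem normLp_sum_le {p : ℝ} (hp : 1 ≤ p) {ι : Type*} (s : Finset ι) (f : ι → C(S2, ℂ)) :
    normLp p (∑ i ∈ s, f i) ≤ ∑ i ∈ s, normLp p (f i) := by
  rw [normLp, ContinuousMap.coe_sum]
  exact lpNorm_sum_le (fun i _ => memLp_continuousMap (f i) _) (by simpa using hp)

theorem normLp_compRotate {p : ℝ} (hp : 0 < p) (f : C(S2, ℂ)) (R : E3 ≃ₗᵢ[ℝ] E3) :
    normLp p (compRotate f R) = normLp p f := by
  rw [normLp_eq hp, normLp_eq hp]
  congr 1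
  exact (measurePreserving_rotate R).integral_comp (measurableEmbedding_rotate R)
    (fun x => ‖f x‖ ^ p)

theorem conj_innerL2 (f g : C(S2, ℂ)) : conj (innerL2 f g) = innerL2 g f := by
  rw [innerL2, innerL2, ← integral_conj]
  congr 1 with x
  simp [mul_comm]

theorem innerL2_self (f : C(S2, ℂ)) : innerL2 f f = ((normLp 2 f ^ 2 : ℝ) : ℂ) := by
  have h : normLp 2 f ^ 2 = ∫ x, ‖f x‖ ^ 2 ∂surf := by
    have h0 : 0 ≤ ∫ x, ‖f x‖ ^ 2 ∂surf := integral_nonneg fun x => by positivity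
    rw [normLp_eq two_pos]
    simp only [Real.rpow_ofNat]
    rw [← Real.rpow_natCast, ← Real.rpow_mul h0]
    norm_num
  rw [h, innerL2, ← integral_complex_ofReal]
  congr 1 with x
  rw [Complex.mul_conj']
  push_cast
  rfl

theorem innerL2_smul_smul (a b : ℂ) (f g : C(S2, ℂ)) :
    innerL2 (a • f) (b • g) = a * conj b * innerL2 f g := by
  rw [innerL2, innerL2, ← integral_const_mul]
  congr 1 with x
  simp; ring

theorem innerL2_sum_smul_sum_smul {ι : Type*} [Fintype ι] (a b : ι → ℂ) (f : ι → C(S2, ℂ)) :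
    innerL2 (∑ i, a i • f i) (∑ j, b j • f j)
      = ∑ i, ∑ j, a i * conj (b j) * innerL2 (f i) (f j) := by
  have hint (i j : ι) :
      Integrable (fun x => a i * conj (b j) * (f i x * conj (f j x))) surf :=
    (integrable_continuousMap (f i * star (f j))).const_mul _
  simp only [innerL2, ← integral_const_mul]
  simp_rw [← integral_finsetSum _ fun j _ => hint _ j]
  rw [← integral_finsetSum _ fun i _ => integrable_finsetSum _ fun j _ => hint i j]
  congr 1 with x
  simp only [ContinuousMap.sum_apply, ContinuousMap.smul_apply, smul_eq_mul, map_sum, map_mul,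
    Finset.sum_mul_sum]
  refine Finset.sum_congr rfl fun i _ => Finset.sum_congr rfl fun j _ => by ring

theorem isHermitian_gramMatrix {m : ℕ} (q : Fin m → C(S2, ℂ)) : (gramMatrix q).IsHermitian := by
  ext i j
  exact conj_innerL2 _ _

/-- The rows of `E ^ (-1/2)` are the coefficients of an orthonormal family. -/
theorem innerL2_sum_isInvSqrt {m : ℕ} {q : Fin m → C(S2, ℂ)} {F : Matrix (Fin m) (Fin m) ℂ}
    (h : IsInvSqrt (gramMatrix q) F) (i j : Fin m) :
    innerL2 (∑ l, F i l • q l) (∑ l, F j l • q l) = if i = j then 1 else 0 := by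
  have h1 := congrFun (congrFun h.mul_mul_eq_one i) j
  rw [Matrix.one_apply] at h1
  rw [innerL2_sum_smul_sum_smul, ← h1, Matrix.mul_apply]
  simp only [Matrix.mul_apply, Finset.sum_mul]
  rw [Finset.sum_comm]
  refine Finset.sum_congr rfl fun b _ => Finset.sum_congr rfl fun a _ => ?_
  have h2 : conj (F j b) = F b j := h.2.1.isHermitian.apply b j
  rw [h2]
  simp only [gramMatrix, Matrix.of_apply]
  ring

/-! ### Powers of isotropic linear forms -/

theorem restrict_apply (P : MvPolynomial (Fin 3) ℂ) (y : S2) :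
    restrict P y = MvPolynomial.eval (fun i => (((y : E3) i : ℝ) : ℂ)) P := by
  induction P using MvPolynomial.induction_on with
  | C a => simp [restrict]
  | add p q hp hq => simp [hp, hq]
  | mul_X p i hp =>
    have h : restrict (p * MvPolynomial.X i) = restrict p * restrict (MvPolynomial.X i) := by
      simp [restrict]
    rw [h, ContinuousMap.mul_apply, hp, map_mul]
    simp [restrict]

open MvPolynomial in
/-- A power of a linear form with isotropic coefficient vector is harmonic, because its Laplacian is
`k * (k - 1) * (∑ i, a i ^ 2)` times the power of exponent `k - 2`. -/
theorem laplacian_linear_pow (a : Fin 3 → ℂ) (ha : ∑ i, a i ^ 2 = 0) (k : ℕ) :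
    laplacian ((∑ i, C (a i) * X i : MvPolynomial (Fin 3) ℂ) ^ k) = 0 := by
  set l : MvPolynomial (Fin 3) ℂ := ∑ i, C (a i) * X i with hl
  have hd (i : Fin 3) : pderiv i l = C (a i) := by
    simp [hl, pderiv_X, Pi.single_apply]
  have hdd (i : Fin 3) : pderiv i (pderiv i (l ^ k))
      = (k : MvPolynomial (Fin 3) ℂ) * (((k - 1 : ℕ) : MvPolynomial (Fin 3) ℂ) * l ^ (k - 1 - 1))
        * C (a i ^ 2) := by
    rw [Derivation.leibniz_pow, hd]
    simp only [nsmul_eq_mul, smul_eq_mul, Derivation.leibniz, Derivation.leibniz_pow, hd,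
      Derivation.map_natCast, pderiv_C, map_pow]
    ring
  simp only [laplacian, LinearMap.sum_apply, LinearMap.comp_apply, Derivation.coeFn_coe, hdd]
  rw [← Finset.mul_sum, ← map_sum, ha, map_zero, mul_zero]

theorem linear_pow_mem_sphericalHarmonics (a : Fin 3 → ℂ) (ha : ∑ i, a i ^ 2 = 0) (k : ℕ)
    (f : C(S2, ℂ)) (hf : ∀ y : S2, f y = (∑ i, a i * (((y : E3) i : ℝ) : ℂ)) ^ k) :
    f ∈ sphericalHarmonics k := by
  refine ⟨(∑ i, MvPolynomial.C (a i) * MvPolynomial.X i) ^ k, ⟨?_, ?_⟩, ?_⟩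
  · rw [SetLike.mem_coe, MvPolynomial.mem_homogeneousSubmodule]
    have : (∑ i, MvPolynomial.C (a i) * MvPolynomial.X i
        : MvPolynomial (Fin 3) ℂ).IsHomogeneous 1 :=
      MvPolynomial.IsHomogeneous.sum _ _ _ fun i _ =>
        by simpa using (MvPolynomial.isHomogeneous_C _ (a i)).mul (MvPolynomial.isHomogeneous_X _ i)
    simpa using this.pow k
  · exact laplacian_linear_pow a ha k
  · ext y
    rw [restrict_apply, hf]
    simp

/-! ### Rotations and their matrices -/

open scoped Matrix RealInnerProductSpace

/-- The linear isometry of `ℝ³` given by a matrix with orthonormal columns. -/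
noncomputable def matrixIsometry (M : Matrix (Fin 3) (Fin 3) ℝ) (hM : Mᵀ * M = 1) :
    E3 ≃ₗᵢ[ℝ] E3 :=
  LinearIsometry.toLinearIsometryEquiv
    { toLinearMap := Matrix.toLpLin 2 2 M
      norm_map' := fun v => by
        rw [← sq_eq_sq₀ (norm_nonneg _) (norm_nonneg _), ← real_inner_self_eq_norm_sq,
          ← real_inner_self_eq_norm_sq, EuclideanSpace.inner_eq_star_dotProduct,
          EuclideanSpace.inner_eq_star_dotProduct, Matrix.ofLp_toLpLin,
          Matrix.toLin'_apply]
        simp only [star_trivial]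
        rw [Matrix.dotProduct_mulVec, Matrix.vecMul_mulVec, hM, Matrix.vecMul_one] }
    rfl

theorem matrixIsometry_apply (M : Matrix (Fin 3) (Fin 3) ℝ) (hM : Mᵀ * M = 1) (v : E3)
    (i : Fin 3) : matrixIsometry M hM v i = M i 0 * v 0 + M i 1 * v 1 + M i 2 * v 2 := by
  have : matrixIsometry M hM v i = (M *ᵥ v.ofLp) i := rfl
  rw [this, Matrix.mulVec_eq_sum]
  simp [Fin.sum_univ_three, mul_comm]

theorem det_matrixIsometry (M : Matrix (Fin 3) (Fin 3) ℝ) (hM : Mᵀ * M = 1) :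
    LinearMap.det ((matrixIsometry M hM).toLinearEquiv : E3 →ₗ[ℝ] E3) = M.det := by
  have : ((matrixIsometry M hM).toLinearEquiv : E3 →ₗ[ℝ] E3) = Matrix.toLpLin 2 2 M := rfl
  rw [this, Matrix.toLpLin_eq_toLin, LinearMap.det_toLin]

/-- The matrix of a linear isometry of `ℝ³` in the standard basis. -/
noncomputable def isometryMatrix (T : E3 ≃ₗᵢ[ℝ] E3) : Matrix (Fin 3) (Fin 3) ℝ :=
  Matrix.of fun i j => T (EuclideanSpace.single j 1) i

theorem isometry_apply_eq_sum (T : E3 ≃ₗᵢ[ℝ] E3) (v : E3) (i : Fin 3) :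
    T v i = ∑ j, isometryMatrix T i j * v j := by
  have h : v = ∑ j, v j • (EuclideanSpace.single j 1 : E3) := by
    ext l
    simp [Pi.single_apply]
  conv_lhs => rw [h]
  simp [isometryMatrix, map_sum, mul_comm]

theorem isometryMatrix_transpose_mul_self (T : E3 ≃ₗᵢ[ℝ] E3) :
    (isometryMatrix T)ᵀ * isometryMatrix T = 1 := by
  ext i j
  have h := T.inner_map_map (EuclideanSpace.single i 1) (EuclideanSpace.single j 1)
  rw [EuclideanSpace.inner_single_left, PiLp.inner_apply] at h
  rw [Matrix.mul_apply, Matrix.one_apply]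
  simpa [isometryMatrix, PiLp.single_apply, mul_comm] using h

theorem det_isometryMatrix (T : E3 ≃ₗᵢ[ℝ] E3) :
    (isometryMatrix T).det = LinearMap.det (T.toLinearEquiv : E3 →ₗ[ℝ] E3) := by
  have h : T = matrixIsometry (isometryMatrix T) (isometryMatrix_transpose_mul_self T) := by
    ext v i
    rw [matrixIsometry_apply, isometry_apply_eq_sum, Fin.sum_univ_three]
  conv_rhs => rw [h, det_matrixIsometry]

theorem isometryMatrix_mul_transpose_self (T : E3 ≃ₗᵢ[ℝ] E3) :
    isometryMatrix T * (isometryMatrix T)ᵀ = 1 :=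
  mul_eq_one_comm.1 (isometryMatrix_transpose_mul_self T)

/-- In a rotation matrix of size three every entry equals its cofactor. -/
theorem isometryMatrix_two_two (T : E3 ≃ₗᵢ[ℝ] E3)
    (hT : LinearMap.det (T.toLinearEquiv : E3 →ₗ[ℝ] E3) = 1) :
    isometryMatrix T 2 2 = isometryMatrix T 0 0 * isometryMatrix T 1 1
      - isometryMatrix T 0 1 * isometryMatrix T 1 0 := by
  have h1 := (isometryMatrix T).mul_adjugate
  rw [det_isometryMatrix, hT, one_smul] at h1
  have h2 : (isometryMatrix T).adjugate = (isometryMatrix T)ᵀ := by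
    rw [← one_mul (isometryMatrix T).adjugate, ← isometryMatrix_transpose_mul_self T, mul_assoc, h1,
      mul_one]
  have h3 := congrFun (congrFun h2 2) 2
  rw [Matrix.adjugate_fin_three] at h3
  simpa using h3.symm

/-! ### Integrals that only see the extreme weight of the circle action -/

/-- The complex coordinate `x₁ + i x₂` on the sphere. -/
noncomputable def planar : C(S2, ℂ) := sectoral 1

/-- The height `x₃` on the sphere. -/
noncomputable def height : C(S2, ℂ) := ⟨fun x => (((x : E3) 2 : ℝ) : ℂ), by fun_prop⟩

theorem planar_apply (y : S2) :
    planar y = (((y : E3) 0 : ℝ) : ℂ) + Complex.I * (((y : E3) 1 : ℝ) : ℂ) := by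
  simp [planar, sectoral]

theorem height_apply (y : S2) : height y = (((y : E3) 2 : ℝ) : ℂ) := rfl

theorem sectoral_eq (k : ℕ) : sectoral k = planar ^ k := by
  ext y
  rw [ContinuousMap.pow_apply, planar_apply]
  rfl

/-- The rotation about the vertical axis which multiplies `x₁ + i x₂` by a unimodular number. -/
theorem exists_axial_rotation (w : ℂ) (hw : ‖w‖ = 1) : ∃ R : E3 ≃ₗᵢ[ℝ] E3, ∀ y : S2,
    planar (rotate R y) = w * planar y ∧ height (rotate R y) = height y := by
  have hw' : w.re * w.re + w.im * w.im = 1 := by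
    rw [← Complex.normSq_apply, Complex.normSq_eq_norm_sq, hw, one_pow]
  refine ⟨matrixIsometry !![w.re, -w.im, 0; w.im, w.re, 0; 0, 0, 1] ?_, fun y => ⟨?_, ?_⟩⟩
  · ext i j
    fin_cases i <;> fin_cases j <;>
      simp [Matrix.mul_apply, Fin.sum_univ_three] <;> linarith
  · rw [planar_apply, planar_apply, coe_rotate, matrixIsometry_apply, matrixIsometry_apply]
    apply Complex.ext <;> simp <;> ring
  · rw [height_apply, height_apply, coe_rotate, matrixIsometry_apply]
    simp

theorem infinite_norm_eq_one : {w : ℂ | ‖w‖ = 1}.Infinite := by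
  have : Infinite (Set.Icc (0 : ℝ) 1) := (Set.Icc_infinite one_pos).to_subtype
  refine Set.infinite_of_injective_forall_mem
    (f := fun t : Set.Icc (0 : ℝ) 1 => (⟨t, Real.sqrt (1 - t ^ 2)⟩ : ℂ)) ?_ ?_
  · intro s t h
    exact Subtype.ext (congrArg Complex.re h)
  · rintro ⟨t, ht0, ht1⟩
    have : (0 : ℝ) ≤ 1 - t ^ 2 := by nlinarith
    rw [Set.mem_ofPred_eq, ← sq_eq_sq₀ (norm_nonneg _) zero_le_one, ← Complex.normSq_eq_norm_sq,
      Complex.normSq_apply, Real.mul_self_sqrt this]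
    ring

/-- Among the monomials of `(b z̄ + c z + d h) ^ k` only `(b z̄) ^ k` is not orthogonal to
`z̄ ^ k`. Here `z = x₁ + i x₂` and `h = x₃`. Rotation about the axis shows that the polynomial
`P(w) = ∫ z ^ k (b z̄ + d w h + c w² z) ^ k` is constant on the unit circle, so `P(1) = P(0)`. -/
theorem integral_planar_pow_mul_linear_pow (b c d : ℂ) (k : ℕ) :
    ∫ y, planar y ^ k * (b * conj (planar y) + c * planar y + d * height y) ^ k ∂surf
      = b ^ k * ∫ y, planar y ^ k * conj (planar y ^ k) ∂surf := by
  let Λ : C(S2, ℂ) →ₗ[ℂ] ℂ :=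
    { toFun := fun f => ∫ y, f y ∂surf
      map_add' := fun f g =>
        integral_add (integrable_continuousMap f) (integrable_continuousMap g)
      map_smul' := fun a f => integral_const_mul a f }
  let A : Polynomial C(S2, ℂ) := Polynomial.C (planar ^ k) *
    (Polynomial.C (b • star planar) + Polynomial.C (d • height) * Polynomial.X
      + Polynomial.C (c • planar) * Polynomial.X ^ 2) ^ k
  let P : Polynomial ℂ :=
    ∑ i ∈ Finset.range (A.natDegree + 1), Polynomial.C (Λ (A.coeff i)) * Polynomial.X ^ i
  have hP (w : ℂ) : P.eval w = ∫ y, planar y ^ k *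
      (b * conj (planar y) + d * height y * w + c * planar y * w ^ 2) ^ k ∂surf := by
    have h1 : P.eval w = Λ (A.eval (algebraMap ℂ C(S2, ℂ) w)) := by
      rw [Polynomial.eval_eq_sum_range (p := A), map_sum, Polynomial.eval_finsetSum]
      refine Finset.sum_congr rfl fun i _ => ?_
      have : A.coeff i * algebraMap ℂ C(S2, ℂ) w ^ i = w ^ i • A.coeff i := by
        rw [← map_pow, mul_comm, ← Algebra.smul_def]
      rw [this, map_smul, Polynomial.eval_mul, Polynomial.eval_C, Polynomial.eval_pow,
        Polynomial.eval_X, smul_eq_mul, mul_comm]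
    rw [h1]
    change ∫ y, (A.eval (algebraMap ℂ C(S2, ℂ) w)) y ∂surf = _
    congr 1 with y
    simp [A]
  have hconst (w : ℂ) (hw : ‖w‖ = 1) : P.eval w = P.eval 1 := by
    obtain ⟨R, hR⟩ := exists_axial_rotation w hw
    have hww : w * conj w = 1 := by rw [Complex.mul_conj', hw]; simp
    -- substituting `y ↦ R y` trades `w` for the factor `w ^ k`, moved into the `k`-th power
    rw [hP, hP, ← (measurePreserving_rotate R).integral_comp (measurableEmbedding_rotate R)
      (fun y => planar y ^ k * (b * conj (planar y) + d * height y * 1 + c * planar y * 1 ^ 2) ^ k)]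
    congr 1 with y
    rw [(hR y).1, (hR y).2, ← mul_pow, ← mul_pow]
    congr 1
    rw [map_mul]
    linear_combination -(b * planar y * conj (planar y)) * hww
  have h10 : P = Polynomial.C (P.eval 1) :=
    Polynomial.eq_of_infinite_eval_eq _ _ <| infinite_norm_eq_one.mono fun w hw => by
      simpa using hconst w hw
  have h0 : P.eval 0 = P.eval 1 := by rw [h10]; simp
  rw [hP, hP] at h0
  rw [← integral_const_mul]
  calc _ = _ := by congr 1 with y; ring
    _ = _ := h0.symm
    _ = _ := by congr 1 with y; simp [mul_pow]; ring

/-! ### The inner product of two Gaussian beams -/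

theorem norm_innerL2_sectoral_compRotate (k : ℕ) (T : E3 ≃ₗᵢ[ℝ] E3)
    (hT : LinearMap.det (T.toLinearEquiv : E3 →ₗ[ℝ] E3) = 1) :
    ‖innerL2 (sectoral k) (compRotate (sectoral k) T)‖
      = ((1 + T (EuclideanSpace.single 2 1) 2) / 2) ^ k * normLp 2 (sectoral k) ^ 2 := by
  set M := isometryMatrix T with hM
  -- the coefficients of `conj (z ∘ T) = b z̄ + c z + d h`
  set b : ℂ := ⟨(M 0 0 + M 1 1) / 2, (M 0 1 - M 1 0) / 2⟩ with hb
  set c : ℂ := ⟨(M 0 0 - M 1 1) / 2, -(M 0 1 + M 1 0) / 2⟩ with hc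
  set d : ℂ := ⟨M 0 2, -M 1 2⟩ with hd
  have hlin (y : S2) : conj (planar (rotate T y))
      = b * conj (planar y) + c * planar y + d * height y := by
    rw [planar_apply, planar_apply, height_apply, coe_rotate, isometry_apply_eq_sum,
      isometry_apply_eq_sum, Fin.sum_univ_three, Fin.sum_univ_three]
    apply Complex.ext <;> simp [hb, hc, hd, ← hM] <;> ring
  have h1 : innerL2 (sectoral k) (compRotate (sectoral k) T)
      = b ^ k * innerL2 (sectoral k) (sectoral k) := by
    simp only [innerL2, sectoral_eq, compRotate_apply, ContinuousMap.pow_apply]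
    rw [← integral_planar_pow_mul_linear_pow b c d k]
    simp only [← hlin, map_pow]
  have h22 : T (EuclideanSpace.single 2 1) 2 = M 2 2 := rfl
  have hcof := isometryMatrix_two_two T hT
  have hMM := isometryMatrix_mul_transpose_self T
  have e0 := congrFun (congrFun hMM 0) 0
  have e1 := congrFun (congrFun hMM 1) 1
  have e2 := congrFun (congrFun (isometryMatrix_transpose_mul_self T) 2) 2
  simp only [Matrix.mul_apply, Fin.sum_univ_three, Matrix.transpose_apply, Matrix.one_apply_eq,
    ← hM] at e0 e1 e2 hcof
  have hM22 : 0 ≤ 1 + M 2 2 := by nlinarith [sq_nonneg (M 0 2), sq_nonneg (M 1 2)]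
  -- the modulus of the weight `-1` coefficient, by orthogonality and the cofactor identity
  have hnb : ‖b‖ = (1 + M 2 2) / 2 := by
    rw [← sq_eq_sq₀ (norm_nonneg _) (by linarith), ← Complex.normSq_eq_norm_sq,
      Complex.normSq_apply]
    simp only [hb]
    linear_combination (e0 + e1 - e2 - 2 * hcof) / 4
  rw [h1, innerL2_self, norm_mul, norm_pow, hnb, h22, Complex.norm_real, Real.norm_eq_abs,
    abs_of_nonneg (by positivity)]

/-- Gaussian beams are coherent states: their overlap depends on the angle `θ` between the poles
only, and its modulus is `cos (θ / 2) ^ (2 * k)`. -/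
theorem norm_innerL2_isGaussianBeam {k : ℕ} (hk : normLp 2 (sectoral k) ≠ 0) {x x' : S2}
    {q q' : C(S2, ℂ)} (h : IsGaussianBeam k x q) (h' : IsGaussianBeam k x' q') :
    ‖innerL2 q q'‖ = ((1 + ⟪(x : E3), x'⟫) / 2) ^ k := by
  obtain ⟨R, hR, hRx, hq⟩ := h
  obtain ⟨R', hR', hRx', hq'⟩ := h'
  set T : E3 ≃ₗᵢ[ℝ] E3 := R.symm.trans R' with hT
  have e1 : q = compRotate (gaussianBeam k) R := ContinuousMap.ext hq
  have e2 : q' = compRotate (compRotate (gaussianBeam k) T) R := by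
    ext y
    rw [hq', compRotate_apply, compRotate_apply]
    congr 1
    exact Subtype.ext (by simp [hT])
  have hdet : LinearMap.det (T.toLinearEquiv : E3 →ₗ[ℝ] E3) = 1 := by
    have : (T.toLinearEquiv : E3 →ₗ[ℝ] E3)
        = (R'.toLinearEquiv : E3 →ₗ[ℝ] E3) ∘ₗ (R.toLinearEquiv.symm : E3 →ₗ[ℝ] E3) := rfl
    rw [this, LinearMap.det_comp, hR', one_mul]
    have h2 := LinearEquiv.det_mul_det_symm R.toLinearEquiv
    rwa [hR, one_mul] at h2
  have hpole : T (EuclideanSpace.single 2 1) 2 = ⟪(x : E3), x'⟫ := by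
    have h3 : T (EuclideanSpace.single 2 1) = R' x := by rw [← hRx]; simp [hT]
    rw [h3, real_inner_comm, ← R'.inner_map_map, hRx', EuclideanSpace.inner_single_left]
    simp
  have e3 : compRotate (gaussianBeam k) T
      = ((normLp 2 (sectoral k) : ℂ)⁻¹) • compRotate (sectoral k) T := rfl
  rw [e1, e2, innerL2_compRotate, e3, gaussianBeam, innerL2_smul_smul, norm_mul,
    norm_innerL2_sectoral_compRotate k T hdet, hpole]
  simp only [norm_mul, norm_inv, RCLike.norm_conj, Complex.norm_real, Real.norm_eq_abs,
    abs_of_nonneg (normLp_nonneg 2 (sectoral k))]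
  field_simp

theorem innerL2_self_isGaussianBeam {k : ℕ} (hk : normLp 2 (sectoral k) ≠ 0) {x : S2}
    {q : C(S2, ℂ)} (h : IsGaussianBeam k x q) : innerL2 q q = 1 := by
  obtain ⟨R, rfl⟩ := h.exists_eq_compRotate
  rw [innerL2_compRotate, innerL2_self, gaussianBeam, normLp_smul]
  simp [abs_of_nonneg (normLp_nonneg 2 (sectoral k)), hk]

theorem IsGaussianBeam.mem_sphericalHarmonics {k : ℕ} {x : S2} {q : C(S2, ℂ)}
    (h : IsGaussianBeam k x q) : q ∈ sphericalHarmonics k := by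
  obtain ⟨R, rfl⟩ := h.exists_eq_compRotate
  refine Submodule.smul_mem _ ((normLp 2 (sectoral k) : ℂ)⁻¹) (x := compRotate (sectoral k) R) ?_
  set M := isometryMatrix R with hM
  refine linear_pow_mem_sphericalHarmonics (fun i => ⟨M 0 i, M 1 i⟩) ?_ k _ fun y => ?_
  · have hMM := isometryMatrix_mul_transpose_self R
    have e0 := congrFun (congrFun hMM 0) 0
    have e1 := congrFun (congrFun hMM 1) 1
    have e2 := congrFun (congrFun hMM 0) 1
    simp [Matrix.mul_apply, Fin.sum_univ_three, ← hM] at e0 e1 e2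
    rw [Fin.sum_univ_three]
    apply Complex.ext <;> simp [pow_two] <;> linarith
  · rw [compRotate_apply, sectoral_eq, ContinuousMap.pow_apply, planar_apply, coe_rotate,
      isometry_apply_eq_sum, isometry_apply_eq_sum, Fin.sum_univ_three, Fin.sum_univ_three,
      Fin.sum_univ_three]
    congr 1
    apply Complex.ext <;> simp [← hM]

/-! ### The moments of the distance to the axis -/

/-- The moment over the sphere, computed through the Gaussian integral
`∫ |v₁ + i v₂| ^ s * exp (-|v|²)` over `ℝ³` in polar coordinates. -/
theorem integral_gaussian_eq_mul_moment {s : ℝ} (hs : 0 < s) :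
    ∫ v : E3, ‖(⟨v 0, v 1⟩ : ℂ)‖ ^ s * Real.exp (-‖v‖ ^ 2)
      = (∫ y, ‖planar y‖ ^ s ∂surf) * (1 / 2 * Real.Gamma (s / 2 + 3 / 2)) := by
  have hdim : Module.finrank ℝ E3 = 3 := by simp
  have hradial : ∫ r : Set.Ioi (0 : ℝ), (r : ℝ) ^ s * Real.exp (-(r : ℝ) ^ 2)
      ∂(Measure.volumeIoiPow (Module.finrank ℝ E3 - 1))
      = 1 / 2 * Real.Gamma (s / 2 + 3 / 2) := by
    rw [hdim]
    simp only [Measure.volumeIoiPow, ENNReal.ofReal]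
    rw [integral_withDensity_eq_integral_smul (by fun_prop), integral_subtype_comap measurableSet_Ioi
      fun r : ℝ => Real.toNNReal (r ^ (3 - 1)) • (r ^ s * Real.exp (-r ^ 2))]
    have h := integral_rpow_mul_exp_neg_rpow (p := 2) (q := s + 2) two_pos (by linarith)
    rw [show (s + 2 + 1) / 2 = s / 2 + 3 / 2 by ring] at h
    rw [← h]
    refine setIntegral_congr_fun measurableSet_Ioi fun r hr => ?_
    have hr : 0 < r := hr
    simp only [NNReal.smul_def, smul_eq_mul]
    rw [Real.coe_toNNReal _ (by positivity), Real.rpow_add hr, Real.rpow_ofNat]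
    ring
  rw [← hradial, ← integral_prod_mul (fun y : S2 => ‖planar y‖ ^ s)]
  have hpres := (volume : Measure E3).measurePreserving_homeomorphUnitSphereProd
  have h1 := hpres.integral_comp (Homeomorph.measurableEmbedding _)
    (fun z : S2 × Set.Ioi (0 : ℝ) => ‖planar z.1‖ ^ s *
      ((z.2 : ℝ) ^ s * Real.exp (-(z.2 : ℝ) ^ 2)))
  have h0 := integral_subtype_comap (μ := (volume : Measure E3)) (measurableSet_singleton 0).compl
    fun v : E3 => ‖(⟨v 0, v 1⟩ : ℂ)‖ ^ s * Real.exp (-‖v‖ ^ 2)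
  rw [restrict_compl_singleton] at h0
  rw [surf, ← h1, ← h0]
  congr 1 with v
  have hv : 0 < ‖(v : E3)‖ := norm_pos_iff.2 v.2
  have h2 : planar ((homeomorphUnitSphereProd E3 v).1)
      = ((‖(v : E3)‖⁻¹ : ℝ) : ℂ) * (⟨(v : E3) 0, (v : E3) 1⟩ : ℂ) := by
    rw [planar_apply]
    apply Complex.ext <;> simp
  rw [h2, homeomorphUnitSphereProd_apply_snd_coe, norm_mul, Complex.norm_real, norm_inv, norm_norm,
    Real.mul_rpow (by positivity) (norm_nonneg _), Real.inv_rpow hv.le]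
  have : ‖(v : E3)‖ ^ s ≠ 0 := (Real.rpow_pos_of_pos hv s).ne'
  field_simp

theorem integral_gaussian_eq {s : ℝ} (hs : 0 < s) :
    ∫ v : E3, ‖(⟨v 0, v 1⟩ : ℂ)‖ ^ s * Real.exp (-‖v‖ ^ 2)
      = Real.sqrt Real.pi * (Real.pi * Real.Gamma (s / 2 + 1)) := by
  have hplane : ∫ u : Fin 2 → ℝ, ‖(⟨u 0, u 1⟩ : ℂ)‖ ^ s * Real.exp (-(u 0 ^ 2 + u 1 ^ 2))
      = Real.pi * Real.Gamma (s / 2 + 1) := by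
    rw [← Complex.volume_preserving_equiv_pi.integral_comp
      Complex.measurableEquivPi.measurableEmbedding]
    have h := Complex.integral_rpow_mul_exp_neg_rpow (p := 2) (q := s) one_le_two (by linarith)
    rw [show (s + 2) / 2 = s / 2 + 1 by ring, mul_div_cancel_left₀ _ two_ne_zero] at h
    rw [← h]
    congr 1 with z
    simp only [Complex.measurableEquivPi_apply, Matrix.cons_val_zero, Matrix.cons_val_one,
      Real.rpow_ofNat]
    congr 3
    rw [← Complex.normSq_eq_norm_sq, Complex.normSq_apply]
    ring
  have hline : ∫ t : ℝ, Real.exp (-t ^ 2) = Real.sqrt Real.pi := by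
    simpa using integral_gaussian 1
  rw [← hplane, ← hline, ← integral_prod_mul (fun t : ℝ => Real.exp (-t ^ 2)),
    ← (PiLp.volume_preserving_toLp (Fin 3)).integral_comp
      (MeasurableEquiv.toLp 2 (Fin 3 → ℝ)).measurableEmbedding]
  have h := (volume_preserving_piFinSuccAbove (fun _ : Fin 3 => ℝ) 2).integral_comp
    (MeasurableEquiv.measurableEmbedding _) (fun z : ℝ × (Fin 2 → ℝ) => Real.exp (-z.1 ^ 2) *
      (‖(⟨z.2 0, z.2 1⟩ : ℂ)‖ ^ s * Real.exp (-(z.2 0 ^ 2 + z.2 1 ^ 2))))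
  refine Eq.trans ?_ h
  congr 1 with v
  have hn : ‖WithLp.toLp 2 v‖ ^ 2 = v 0 ^ 2 + v 1 ^ 2 + v 2 ^ 2 := by
    rw [EuclideanSpace.norm_sq_eq, Fin.sum_univ_three]; simp
  have e0 : (MeasurableEquiv.piFinSuccAbove (fun _ : Fin 3 => ℝ) 2 v).2 0 = v 0 := rfl
  have e1 : (MeasurableEquiv.piFinSuccAbove (fun _ : Fin 3 => ℝ) 2 v).2 1 = v 1 := rfl
  have e2 : (MeasurableEquiv.piFinSuccAbove (fun _ : Fin 3 => ℝ) 2 v).1 = v 2 := rfl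
  rw [e0, e1, e2, hn, mul_left_comm, ← Real.exp_add]
  congr 2
  ring_nf

/-- The quotient `Γ(x + 1) / Γ(x + 3/2)`. -/
noncomputable def gammaQuot (x : ℝ) : ℝ := Real.Gamma (x + 1) / Real.Gamma (x + 3 / 2)

theorem gammaQuot_pos {x : ℝ} (hx : 0 < x) : 0 < gammaQuot x :=
  div_pos (Real.Gamma_pos_of_pos (by linarith)) (Real.Gamma_pos_of_pos (by linarith))

theorem integral_norm_planar_rpow {s : ℝ} (hs : 0 < s) :
    ∫ y, ‖planar y‖ ^ s ∂surf
      = 2 * Real.pi * Real.sqrt Real.pi * gammaQuot (s / 2) := by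
  have h := integral_gaussian_eq_mul_moment hs
  rw [integral_gaussian_eq hs] at h
  have h0 : 0 < Real.Gamma (s / 2 + 3 / 2) := Real.Gamma_pos_of_pos (by linarith)
  rw [gammaQuot, mul_div_assoc', eq_div_iff h0.ne']
  linarith

/-- Log-convexity of `Γ` at the midpoint of `x` and `x + 1`. -/
theorem Gamma_add_half_sq_le {x : ℝ} (hx : 0 < x) :
    Real.Gamma (x + 1 / 2) ^ 2 ≤ x * Real.Gamma x ^ 2 := by
  have h := Real.Gamma_mul_add_mul_le_rpow_Gamma_mul_rpow_Gamma hx (t := x + 1) (by linarith)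
    (a := 1 / 2) (b := 1 / 2) (by norm_num) (by norm_num) (by norm_num)
  rw [show 1 / 2 * x + 1 / 2 * (x + 1) = x + 1 / 2 by ring, ← Real.sqrt_eq_rpow,
    ← Real.sqrt_eq_rpow] at h
  have h0 := Real.Gamma_pos_of_pos hx
  have h1 : 0 < Real.Gamma (x + 1 / 2) := Real.Gamma_pos_of_pos (by linarith)
  calc _ ≤ (Real.sqrt (Real.Gamma x) * Real.sqrt (Real.Gamma (x + 1))) ^ 2 := by gcongr
    _ = Real.Gamma x * Real.Gamma (x + 1) := by
      rw [mul_pow, Real.sq_sqrt h0.le, Real.sq_sqrt (Real.Gamma_pos_of_pos (by linarith)).le]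
    _ = _ := by rw [Real.Gamma_add_one hx.ne']; ring

theorem gammaQuot_sq_mul_le {x : ℝ} (hx : 0 < x) : gammaQuot x ^ 2 * x ≤ 1 := by
  have h := Gamma_add_half_sq_le (x := x + 1 / 2) (by linarith)
  have h1 := Real.Gamma_add_one (s := x + 1 / 2) (by positivity)
  rw [show x + 1 / 2 + 1 / 2 = x + 1 by ring] at h
  rw [show x + 1 / 2 + 1 = x + 3 / 2 by ring] at h1
  have h2 : 0 < Real.Gamma (x + 3 / 2) := Real.Gamma_pos_of_pos (by linarith)
  rw [gammaQuot, div_pow, div_mul_eq_mul_div, div_le_one (by positivity)]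
  have h3 : 0 ≤ Real.Gamma (x + 1) ^ 2 := sq_nonneg _
  calc _ ≤ Real.Gamma (x + 1) ^ 2 * (x + 1 / 2) := by gcongr; linarith
    _ ≤ (x + 1 / 2) * Real.Gamma (x + 1 / 2) ^ 2 * (x + 1 / 2) := by gcongr
    _ = _ := by rw [h1]; ring

theorem div_le_gammaQuot_sq_mul {x : ℝ} (hx : 0 < x) : x / (x + 1) ≤ gammaQuot x ^ 2 * x := by
  have h := Gamma_add_half_sq_le (x := x + 1) (by linarith)
  rw [show x + 1 + 1 / 2 = x + 3 / 2 by ring] at h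
  have h2 : 0 < Real.Gamma (x + 3 / 2) := Real.Gamma_pos_of_pos (by linarith)
  rw [gammaQuot, div_pow, div_mul_eq_mul_div, div_le_div_iff₀ (by positivity) (by positivity)]
  nlinarith

/-! ### The norms of the sectoral harmonics -/

theorem normLp_sectoral {p : ℝ} (hp : 0 < p) {k : ℕ} (hk : 0 < k) :
    normLp p (sectoral k)
      = (2 * Real.pi * Real.sqrt Real.pi * gammaQuot (k * p / 2)) ^ p⁻¹ := by
  have hk' : (0 : ℝ) < k := by exact_mod_cast hk
  rw [normLp_eq hp, ← integral_norm_planar_rpow (by positivity)]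
  congr 2 with y
  rw [sectoral_eq, ContinuousMap.pow_apply, norm_pow, ← Real.rpow_natCast, ← Real.rpow_mul
    (norm_nonneg _)]

theorem normLp_sectoral_pos {p : ℝ} (hp : 0 < p) {k : ℕ} (hk : 0 < k) :
    0 < normLp p (sectoral k) := by
  have hk' : (0 : ℝ) < k := by exact_mod_cast hk
  rw [normLp_sectoral hp hk]
  have := gammaQuot_pos (x := k * p / 2) (by positivity)
  positivity

theorem normLp_gaussianBeam (p : ℝ) (k : ℕ) :
    normLp p (gaussianBeam k) = normLp p (sectoral k) / normLp 2 (sectoral k) := by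
  rw [gaussianBeam, normLp_smul, norm_inv, Complex.norm_real, Real.norm_eq_abs,
    abs_of_nonneg (normLp_nonneg _ _)]
  ring

/-- The limit of `‖Q_k‖_p / k ^ σ(p)`. -/
noncomputable def beamConst (p : ℝ) : ℝ :=
  (2 * Real.pi * Real.sqrt Real.pi) ^ (1 / p - 1 / 2) * (p / 2) ^ (-(1 / (2 * p)))

theorem beamConst_pos {p : ℝ} (hp : 0 < p) : 0 < beamConst p := by
  unfold beamConst; positivity

theorem normLp_gaussianBeam_eq {p : ℝ} (hp : 0 < p) {k : ℕ} (hk : 0 < k) :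
    normLp p (gaussianBeam k) = beamConst p * (k : ℝ) ^ sigma p *
      ((gammaQuot (k * p / 2) ^ 2 * (k * p / 2)) ^ (1 / (2 * p))
        / (gammaQuot k ^ 2 * k) ^ (1 / 4 : ℝ)) := by
  have hk' : (0 : ℝ) < k := by exact_mod_cast hk
  have key (c g g' x : ℝ) (hc : 0 < c) (hg : 0 < g) (hg' : 0 < g') (hx : 0 < x) :
      (c * g) ^ p⁻¹ / (c * g') ^ (2 : ℝ)⁻¹ = c ^ (1 / p - 1 / 2) * (p / 2) ^ (-(1 / (2 * p))) *
        x ^ (1 / 2 * (1 / 2 - 1 / p)) *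
          ((g ^ 2 * (x * (p / 2))) ^ (1 / (2 * p)) / (g' ^ 2 * x) ^ (1 / 4 : ℝ)) := by
    have hp2 : 0 < p / 2 := by positivity
    -- after taking logarithms this is a linear identity
    refine Real.log_injOn_pos (Set.mem_Ioi.2 (by positivity)) (Set.mem_Ioi.2 (by positivity)) ?_
    have l1 : Real.log ((c * g) ^ p⁻¹) = p⁻¹ * (Real.log c + Real.log g) := by
      rw [Real.log_rpow (by positivity), Real.log_mul hc.ne' hg.ne']
    have l2 : Real.log ((c * g') ^ (2 : ℝ)⁻¹) = 2⁻¹ * (Real.log c + Real.log g') := by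
      rw [Real.log_rpow (by positivity), Real.log_mul hc.ne' hg'.ne']
    have l3 : Real.log ((g ^ 2 * (x * (p / 2))) ^ (1 / (2 * p)))
        = 1 / (2 * p) * (2 * Real.log g + (Real.log x + Real.log (p / 2))) := by
      rw [Real.log_rpow (by positivity), Real.log_mul (by positivity) (by positivity),
        Real.log_pow, Real.log_mul hx.ne' hp2.ne']
      norm_num
    have l4 : Real.log ((g' ^ 2 * x) ^ (1 / 4 : ℝ))
        = 1 / 4 * (2 * Real.log g' + Real.log x) := by
      rw [Real.log_rpow (by positivity), Real.log_mul (by positivity) (by positivity),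
        Real.log_pow]
      norm_num
    rw [Real.log_div (by positivity) (by positivity), l1, l2,
      Real.log_mul (by positivity) (by positivity), Real.log_div (by positivity) (by positivity),
      l3, l4, Real.log_mul (by positivity) (by positivity),
      Real.log_mul (by positivity) (by positivity), Real.log_rpow hc, Real.log_rpow hp2,
      Real.log_rpow hx]
    field_simp
    ring
  rw [normLp_gaussianBeam, normLp_sectoral hp hk, normLp_sectoral two_pos hk, beamConst,
    mul_div_cancel_right₀ _ two_ne_zero, sigma, mul_div_assoc]
  exact key _ _ _ _ (by positivity) (gammaQuot_pos (by positivity)) (gammaQuot_pos hk') hk'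

/-- The two factors `gammaQuot x ^ 2 * x` lie in `[k / (k + 1), 1]`, hence so do their powers with
exponents in `[0, 1]`. The relative error does not depend on `p`. -/
theorem normLp_gaussianBeam_bounds {p : ℝ} (hp : 2 < p) {k : ℕ} (hk : 0 < k) :
    (k : ℝ) / (k + 1) * (beamConst p * (k : ℝ) ^ sigma p) ≤ normLp p (gaussianBeam k) ∧
      normLp p (gaussianBeam k) ≤ ((k : ℝ) / (k + 1))⁻¹ * (beamConst p * (k : ℝ) ^ sigma p) := by
  have hk' : (0 : ℝ) < k := by exact_mod_cast hk
  have hp0 : 0 < p := by linarith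
  have hx : (k : ℝ) ≤ k * p / 2 := by nlinarith
  set t : ℝ := k / (k + 1) with ht
  have ht0 : 0 < t := by positivity
  have ht1 : t ≤ 1 := by rw [ht, div_le_one (by positivity)]; linarith
  have hA1 : gammaQuot (k * p / 2) ^ 2 * (k * p / 2) ≤ 1 := gammaQuot_sq_mul_le (by positivity)
  have hA2 : t ≤ gammaQuot (k * p / 2) ^ 2 * (k * p / 2) := by
    refine le_trans ?_ (div_le_gammaQuot_sq_mul (by positivity))
    rw [ht, div_le_div_iff₀ (by positivity) (by positivity)]
    nlinarith
  have hB1 : gammaQuot k ^ 2 * k ≤ 1 := gammaQuot_sq_mul_le hk'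
  have hB2 : t ≤ gammaQuot k ^ 2 * k := div_le_gammaQuot_sq_mul hk'
  rw [normLp_gaussianBeam_eq hp0 hk]
  set A := gammaQuot (k * p / 2) ^ 2 * (k * p / 2)
  set B := gammaQuot k ^ 2 * k
  have key {a : ℝ} {e : ℝ} (h1 : t ≤ a) (h2 : a ≤ 1) (he0 : 0 ≤ e) (he1 : e ≤ 1) :
      t ≤ a ^ e ∧ a ^ e ≤ 1 := by
    refine ⟨h1.trans ?_, Real.rpow_le_one (by linarith) h2 he0⟩
    simpa using Real.rpow_le_rpow_of_exponent_ge (by linarith) h2 he1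
  obtain ⟨a1, a2⟩ := key hA2 hA1 (e := 1 / (2 * p)) (by positivity)
    (by rw [div_le_one (by positivity)]; linarith)
  obtain ⟨b1, b2⟩ := key hB2 hB1 (e := 1 / 4) (by norm_num) (by norm_num)
  have hb0 : 0 < B ^ (1 / 4 : ℝ) := by linarith
  have hM : 0 ≤ beamConst p * (k : ℝ) ^ sigma p := by
    have := beamConst_pos hp0
    positivity
  rw [mul_comm t, mul_comm t⁻¹]
  constructor
  · gcongr
    rw [le_div_iff₀ hb0]
    nlinarith
  · gcongr
    rw [div_le_iff₀ hb0, inv_mul_eq_div, le_div_iff₀ ht0]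
    nlinarith

theorem tendsto_normLp_gaussianBeam {p : ℝ} (hp : 2 < p) :
    Tendsto (fun k : ℕ => normLp p (gaussianBeam k) / (k : ℝ) ^ sigma p) atTop
      (𝓝 (beamConst p)) := by
  have h1 : Tendsto (fun k : ℕ => (k : ℝ) / (k + 1)) atTop (𝓝 1) :=
    tendsto_natCast_div_add_atTop (1 : ℝ)
  have h2 : Tendsto (fun k : ℕ => (k : ℝ) / (k + 1) * beamConst p) atTop (𝓝 (beamConst p)) := by
    simpa using h1.mul_const (beamConst p)
  have h3 : Tendsto (fun k : ℕ => ((k : ℝ) / (k + 1))⁻¹ * beamConst p) atTop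
      (𝓝 (beamConst p)) := by
    simpa using (h1.inv₀ one_ne_zero).mul_const (beamConst p)
  refine tendsto_of_tendsto_of_tendsto_of_le_of_le' h2 h3 ?_ ?_ <;>
    filter_upwards [eventually_gt_atTop 0] with k hk <;>
    have hk' : (0 : ℝ) < (k : ℝ) ^ sigma p := Real.rpow_pos_of_pos (by exact_mod_cast hk) _
  · rw [le_div_iff₀ hk', mul_assoc]
    exact (normLp_gaussianBeam_bounds hp hk).1
  · rw [div_le_iff₀ hk', mul_assoc]
    exact (normLp_gaussianBeam_bounds hp hk).2

/-! ### A separated family of poles -/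

/-- The rotation that takes the pole along a great circle to the north pole. Its matrix has entries
rational in the coordinates, with denominator `1 + x₃`, which excludes the south pole. -/
theorem exists_isGaussianBeam (k : ℕ) (x : S2) (hx : -1 < (x : E3) 2) :
    ∃ q, IsGaussianBeam k x q := by
  set a := (x : E3) 0 with ha
  set b := (x : E3) 1 with hb
  set c := (x : E3) 2 with hc
  set t := (1 + c)⁻¹ with ht'
  have hs : a ^ 2 + b ^ 2 + c ^ 2 = 1 := by
    have h1 : ‖(x : E3)‖ ^ 2 = 1 := by simp
    rwa [EuclideanSpace.norm_sq_eq, Fin.sum_univ_three, Real.norm_eq_abs, Real.norm_eq_abs,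
      Real.norm_eq_abs, sq_abs, sq_abs, sq_abs] at h1
  have ht : t * (1 + c) = 1 := inv_mul_cancel₀ (by linarith)
  have hu : t * (a ^ 2 + b ^ 2) = 1 - c := by linear_combination t * hs + (1 - c) * ht
  let M : Matrix (Fin 3) (Fin 3) ℝ :=
    !![1 - a ^ 2 * t, -(a * b * t), -a; -(a * b * t), 1 - b ^ 2 * t, -b; a, b, c]
  have hM : Mᵀ * M = 1 := by
    ext i j
    fin_cases i <;> fin_cases j <;> simp [M, Matrix.mul_apply, Fin.sum_univ_three]
    · linear_combination a ^ 2 * t * hu - a ^ 2 * ht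
    · linear_combination a * b * t * hu - a * b * ht
    · linear_combination a * hu
    · linear_combination a * b * t * hu - a * b * ht
    · linear_combination b ^ 2 * t * hu - b ^ 2 * ht
    · linear_combination b * hu
    · linear_combination a * hu
    · linear_combination b * hu
    · linear_combination hs
  refine ⟨compRotate (gaussianBeam k) (matrixIsometry M hM), matrixIsometry M hM, ?_, ?_,
    fun y => rfl⟩
  · rw [det_matrixIsometry, Matrix.det_fin_three]
    simp [M]
    linear_combination hs - c * hu
  · ext i
    rw [matrixIsometry_apply]
    fin_cases i <;> simp [M, ← ha, ← hb, ← hc]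
    · linear_combination -a * hu
    · linear_combination -b * hu
    · linear_combination hs

/-- The point of the upper hemisphere above a point of the unit disc. -/
noncomputable def liftPoint (α β : ℝ) (h : α ^ 2 + β ^ 2 ≤ 1) : S2 :=
  ⟨!₂[α, β, Real.sqrt (1 - α ^ 2 - β ^ 2)], by
    have h1 : 0 ≤ 1 - α ^ 2 - β ^ 2 := by linarith
    rw [mem_sphere_zero_iff_norm, ← sq_eq_sq₀ (norm_nonneg _) zero_le_one,
      EuclideanSpace.norm_sq_eq, Fin.sum_univ_three]
    simp [Real.sq_sqrt h1]⟩

theorem liftPoint_two_nonneg (α β : ℝ) (h : α ^ 2 + β ^ 2 ≤ 1) :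
    0 ≤ (liftPoint α β h : E3) 2 := by
  simp [liftPoint]

/-- Lifting to the sphere does not decrease distances. -/
theorem inner_liftPoint_le (α β α' β' : ℝ) (h : α ^ 2 + β ^ 2 ≤ 1) (h' : α' ^ 2 + β' ^ 2 ≤ 1) :
    ⟪(liftPoint α β h : E3), liftPoint α' β' h'⟫
      ≤ 1 - ((α - α') ^ 2 + (β - β') ^ 2) / 2 := by
  have h1 : 0 ≤ 1 - α ^ 2 - β ^ 2 := by linarith
  have h2 : 0 ≤ 1 - α' ^ 2 - β' ^ 2 := by linarith
  rw [PiLp.inner_apply, Fin.sum_univ_three]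
  simp only [liftPoint, RCLike.inner_apply, conj_trivial, Matrix.cons_val_zero,
    Matrix.cons_val_one, Matrix.cons_val]
  nlinarith [sq_nonneg (Real.sqrt (1 - α ^ 2 - β ^ 2) - Real.sqrt (1 - α' ^ 2 - β' ^ 2)),
    Real.sq_sqrt h1, Real.sq_sqrt h2]

/-- The points are lifts of the first `m` points of an `n × n` grid of mesh `1 / √m` in the square of
side `n / √m` centred at the origin. Index `i` stands in row `i / n` and column `i % n`. -/
theorem exists_grid_points {m : ℕ} (hm : 9 ≤ m) : ∃ (n : ℕ) (x : Fin m → S2), 0 < n ∧ m ≤ n * n ∧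
    (∀ i, 0 ≤ (x i : E3) 2) ∧ ∀ i j, ⟪(x i : E3), x j⟫
      ≤ 1 - ((((i / n : ℕ) : ℝ) - ((j / n : ℕ) : ℝ)) ^ 2
        + (((i % n : ℕ) : ℝ) - ((j % n : ℕ) : ℝ)) ^ 2) / (2 * m) := by
  obtain ⟨n, hn0, hmn, hn⟩ : ∃ n : ℕ, 0 < n ∧ m ≤ n * n ∧ n * n ≤ 2 * m := by
    -- the square of side `n / √m` lies in the unit disc when `n ^ 2 ≤ 2 * m`
    have h3 : 3 ≤ Nat.sqrt m := Nat.le_sqrt.2 hm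
    have h4 := Nat.sqrt_le m
    exact ⟨Nat.sqrt m + 1, by lia, (Nat.lt_succ_sqrt m).le, by nlinarith⟩
  have hm0 : (0 : ℝ) < m := by exact_mod_cast (by lia : 0 < m)
  have hnR : (n : ℝ) * n ≤ 2 * m := by exact_mod_cast hn
  set s := Real.sqrt m with hs
  have hs0 : 0 < s := Real.sqrt_pos.2 hm0
  have hss : s ^ 2 = m := Real.sq_sqrt hm0.le
  have hbound (a : ℕ) (ha : a < n) : (((a : ℝ) - n / 2) / s) ^ 2 ≤ 1 / 2 := by
    have h1 : (a : ℝ) ≤ n := by exact_mod_cast ha.le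
    have h2 : (0 : ℝ) ≤ a := a.cast_nonneg
    rw [div_pow, hss, div_le_iff₀ hm0]
    nlinarith
  have hdisc (i : Fin m) : ((((i / n : ℕ) : ℝ) - n / 2) / s) ^ 2
      + ((((i % n : ℕ) : ℝ) - n / 2) / s) ^ 2 ≤ 1 := by
    have h1 := hbound (i / n) (Nat.div_lt_of_lt_mul (i.2.trans_le hmn))
    have h2 := hbound (i % n) (Nat.mod_lt _ hn0)
    linarith
  refine ⟨n, fun i => liftPoint _ _ (hdisc i), hn0, hmn, fun i => liftPoint_two_nonneg _ _ _,
    fun i j => (inner_liftPoint_le _ _ _ _ (hdisc i) (hdisc j)).trans (le_of_eq ?_)⟩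
  rw [← hss]
  field_simp
  ring

theorem sum_range_pow_natAbs_sub_le (n a : ℕ) :
    ∑ b ∈ Finset.range n, (1 / 100 : ℝ) ^ ((a : ℤ) - b).natAbs ≤ 101 / 99 := by
  have hgeom (l : ℕ) : ∑ i ∈ Finset.range l, (1 / 100 : ℝ) ^ i ≤ 100 / 99 := by
    have h := (summable_geometric_of_lt_one (r := (1 / 100 : ℝ)) (by norm_num)
      (by norm_num)).sum_le_tsum (Finset.range l) fun i _ => by positivity
    rw [tsum_geometric_of_lt_one (by norm_num) (by norm_num)] at h
    exact h.trans (by norm_num)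
  calc _ ≤ ∑ b ∈ Finset.range (a + n), (1 / 100 : ℝ) ^ ((a : ℤ) - b).natAbs :=
        Finset.sum_le_sum_of_subset_of_nonneg (by simp) fun i _ _ => by positivity
    _ = 1 / 100 * ∑ i ∈ Finset.range a, (1 / 100 : ℝ) ^ i
        + ∑ i ∈ Finset.range n, (1 / 100 : ℝ) ^ i := by
      rw [Finset.sum_range_add, ← Finset.sum_range_reflect, Finset.mul_sum]
      congr 1
      · refine Finset.sum_congr rfl fun i hi => ?_
        have hi := Finset.mem_range.1 hi
        rw [← pow_succ']
        congr 1
        lia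
      · refine Finset.sum_congr rfl fun i _ => ?_
        congr 1
        lia
    _ ≤ 1 / 100 * (100 / 99) + 100 / 99 := by gcongr <;> exact hgeom _
    _ = 101 / 99 := by norm_num

/-- The `ℓ¹` distance of the positions of two indices in the `n × n` grid with row-by-row enumeration. -/
def gridDist (n i j : ℕ) : ℕ :=
  (((i / n : ℕ) : ℤ) - (j / n : ℕ)).natAbs + (((i % n : ℕ) : ℤ) - (j % n : ℕ)).natAbs

theorem gridDist_self (n i : ℕ) : gridDist n i i = 0 := by simp [gridDist]

theorem gridDist_pos {n i j : ℕ} (h : i ≠ j) : 0 < gridDist n i j := by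
  by_contra h0
  have h1 : i / n = j / n ∧ i % n = j % n := by
    simp only [gridDist] at h0
    lia
  exact h (by rw [← Nat.div_add_mod i n, ← Nat.div_add_mod j n, h1.1, h1.2])

theorem gridDist_le (n i j : ℕ) : (gridDist n i j : ℝ)
    ≤ (((i / n : ℕ) : ℝ) - ((j / n : ℕ) : ℝ)) ^ 2
        + (((i % n : ℕ) : ℝ) - ((j % n : ℕ) : ℝ)) ^ 2 := by
  have h (z : ℤ) : (z.natAbs : ℝ) ≤ (z : ℝ) ^ 2 := by
    rw [Nat.cast_natAbs]
    exact_mod_cast Int.natCast_natAbs z ▸ Int.natAbs_le_self_sq z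
  rw [gridDist]
  push_cast
  refine add_le_add ((h _).trans_eq ?_) ((h _).trans_eq ?_) <;> push_cast <;> rfl

theorem sum_pow_gridDist_le {m n : ℕ} (hn : 0 < n) (hmn : m ≤ n * n) (i : ℕ) :
    ∑ j : Fin m, (1 / 100 : ℝ) ^ gridDist n i j ≤ 6 / 5 := by
  have hinj : Set.InjOn (fun j : Fin m => ((j : ℕ) / n, (j : ℕ) % n))
      (Finset.univ : Finset (Fin m)) := by
    intro j _ j' _ h
    obtain ⟨h1, h2⟩ := Prod.mk.inj h
    exact Fin.ext (by rw [← Nat.div_add_mod j n, ← Nat.div_add_mod j' n, h1, h2])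
  calc _ = ∑ z ∈ Finset.univ.image (fun j : Fin m => ((j : ℕ) / n, (j : ℕ) % n)),
        (1 / 100 : ℝ) ^ (((i / n : ℕ) : ℤ) - z.1).natAbs *
          (1 / 100 : ℝ) ^ (((i % n : ℕ) : ℤ) - z.2).natAbs := by
        rw [Finset.sum_image hinj]
        exact Finset.sum_congr rfl fun j _ => by rw [gridDist, pow_add]
    _ ≤ ∑ z ∈ Finset.range n ×ˢ Finset.range n,
        (1 / 100 : ℝ) ^ (((i / n : ℕ) : ℤ) - z.1).natAbs *
          (1 / 100 : ℝ) ^ (((i % n : ℕ) : ℤ) - z.2).natAbs := by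
        refine Finset.sum_le_sum_of_subset_of_nonneg ?_ fun z _ _ => by positivity
        intro z hz
        obtain ⟨j, -, rfl⟩ := Finset.mem_image.1 hz
        simp only [Finset.mem_product, Finset.mem_range]
        exact ⟨Nat.div_lt_of_lt_mul (j.2.trans_le hmn), Nat.mod_lt _ hn⟩
    _ = (∑ a ∈ Finset.range n, (1 / 100 : ℝ) ^ (((i / n : ℕ) : ℤ) - a).natAbs) *
        ∑ b ∈ Finset.range n, (1 / 100 : ℝ) ^ (((i % n : ℕ) : ℤ) - b).natAbs :=
        by rw [Finset.sum_mul_sum, Finset.sum_product]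
    _ ≤ 101 / 99 * (101 / 99) := by
        gcongr <;> exact sum_range_pow_natAbs_sub_le _ _
    _ ≤ 6 / 5 := by norm_num

/-- Unit vectors whose chord has length at least `r` make an angle of at least `r`. -/
theorem le_angle_of_inner_le {x y : S2} {r : ℝ}
    (h : ⟪(x : E3), y⟫ ≤ 1 - r ^ 2 / 2) :
    r ≤ InnerProductGeometry.angle (x : E3) y := by
  have h1 := InnerProductGeometry.cos_angle (x : E3) (y : E3)
  have hx : ‖(x : E3)‖ = 1 := by simp
  have hy : ‖(y : E3)‖ = 1 := by simp
  rw [hx, hy, mul_one, div_one] at h1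
  have h2 := Real.one_sub_sq_div_two_le_cos (x := InnerProductGeometry.angle (x : E3) y)
  refine abs_le_of_sq_le_sq' ?_ (InnerProductGeometry.angle_nonneg _ _) |>.2
  linarith

/-- An overlap of Gaussian beams is at most a Gaussian in the length of the chord. -/
theorem overlap_le_pow {k m N : ℕ} {c d : ℝ} (hm : 0 < m) (hkm : 20 * m ≤ k) (hN : (N : ℝ) ≤ d)
    (hc : -1 ≤ c) (h : c ≤ 1 - d / (2 * m)) : ((1 + c) / 2) ^ k ≤ (1 / 100 : ℝ) ^ N := by
  have hm' : (0 : ℝ) < m := by exact_mod_cast hm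
  have hkm' : (20 : ℝ) * m ≤ k := by exact_mod_cast hkm
  have hd : 0 ≤ d := N.cast_nonneg.trans hN
  have h1 : (1 + c) / 2 ≤ Real.exp (-(d / (4 * m))) := by
    refine le_trans ?_ (Real.add_one_le_exp _)
    have : d / (2 * m) = 2 * (d / (4 * m)) := by field_simp; norm_num
    linarith
  have he : Real.exp (-5) ≤ 1 / 100 := by
    rw [Real.exp_neg, one_div]
    refine inv_anti₀ (by norm_num) ?_
    have h2 : Real.exp 5 = Real.exp 1 ^ 5 := by rw [← Real.exp_nat_mul]; norm_num
    rw [h2]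
    have h3 := Real.exp_one_gt_d9
    calc (100 : ℝ) ≤ 2.7 ^ 5 := by norm_num
      _ ≤ _ := by gcongr; linarith
  calc ((1 + c) / 2) ^ k ≤ Real.exp (-(d / (4 * m))) ^ k := by gcongr; linarith
    _ = Real.exp (-(k * (d / (4 * m)))) := by rw [← Real.exp_nat_mul]; congr 1; ring
    _ ≤ Real.exp (N * (-5)) := by
      refine Real.exp_le_exp.2 ?_
      have h4 : (5 : ℝ) * d ≤ k * (d / (4 * m)) := by
        rw [mul_div_assoc', le_div_iff₀ (by positivity)]
        nlinarith
      linarith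
    _ = Real.exp (-5) ^ N := by rw [Real.exp_nat_mul]
    _ ≤ _ := by gcongr

/-- A family of Gaussian beams, almost orthonormal in the row-sum norm. -/
theorem exists_almost_orthonormal_beams {k m : ℕ} (hm : 9 ≤ m) (hkm : 20 * m ≤ k) :
    ∃ (x : Fin m → S2) (q : Fin m → C(S2, ℂ)), (∀ i, IsGaussianBeam k (x i) (q i)) ∧
      (∀ i j, i ≠ j → 1 / Real.sqrt m ≤ InnerProductGeometry.angle (x i : E3) (x j)) ∧
      ∀ i, ∑ j, ‖(gramMatrix q - 1) i j‖ ≤ 1 / 5 := by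
  obtain ⟨n, x, hn, hmn, hx2, hx⟩ := exists_grid_points hm
  choose q hq using fun i => exists_isGaussianBeam k (x i) (by linarith [hx2 i])
  have hm0 : 0 < m := by lia
  have hm' : (0 : ℝ) < m := by exact_mod_cast hm0
  have hk0 : normLp 2 (sectoral k) ≠ 0 := (normLp_sectoral_pos two_pos (by lia)).ne'
  have hentry (i j : Fin m) : ‖(gramMatrix q - 1) i j‖
      ≤ (1 / 100 : ℝ) ^ gridDist n i j - if j = i then 1 else 0 := by
    rw [Matrix.sub_apply, gramMatrix, Matrix.of_apply]
    by_cases h : j = i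
    · subst h
      simp [innerL2_self_isGaussianBeam hk0 (hq j), gridDist_self]
    · rw [Matrix.one_apply_ne (Ne.symm h), sub_zero, if_neg h, sub_zero,
        norm_innerL2_isGaussianBeam hk0 (hq i) (hq j)]
      refine overlap_le_pow hm0 hkm (gridDist_le n i j) ?_ (hx i j)
      have h1 := neg_le_of_abs_le (abs_real_inner_le_norm (x i : E3) (x j))
      simpa using h1
  refine ⟨x, q, hq, fun i j hij => le_angle_of_inner_le ((hx i j).trans ?_),
    fun i => ?_⟩
  · have h1 : (1 : ℝ) ≤ gridDist n i j := by
      exact_mod_cast gridDist_pos fun h => hij (Fin.ext h)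
    have h2 := h1.trans (gridDist_le n i j)
    rw [div_pow, one_pow, Real.sq_sqrt hm'.le, div_div, mul_comm (m : ℝ) 2]
    gcongr
  · calc _ ≤ ∑ j : Fin m, ((1 / 100 : ℝ) ^ gridDist n i j - if j = i then 1 else 0) :=
          Finset.sum_le_sum fun j _ => hentry i j
      _ = ∑ j : Fin m, (1 / 100 : ℝ) ^ gridDist n i j - 1 := by
          rw [Finset.sum_sub_distrib]; simp
      _ ≤ 1 / 5 := by linarith [sum_pow_gridDist_le hn hmn i]

/-! ### The density condition -/

theorem densityCondition_one_div_400 : DensityCondition (1 / 400) := by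
  -- `exp (50 / 9) ≥ 256`, because `exp 50 > 2 ^ 72`
  have h1 : (256 : ℝ) ≤ Real.exp (50 / 9) := by
    have h2 : Real.exp (50 / 9) ^ 9 = Real.exp 1 ^ 50 := by
      rw [← Real.exp_nat_mul, ← Real.exp_nat_mul]; norm_num
    refine le_of_pow_le_pow_left₀ (n := 9) (by norm_num) (Real.exp_pos _).le ?_
    rw [h2]
    calc (256 : ℝ) ^ 9 ≤ 2.718 ^ 50 := by norm_num
      _ ≤ _ := by gcongr; linarith [Real.exp_one_gt_d9]
  rw [DensityCondition, show (-1 / (72 * (1 / 400)) : ℝ) = -(50 / 9) by norm_num, Real.exp_neg,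
    ← div_eq_mul_inv, div_le_iff₀ (Real.exp_pos _)]
  linarith

/-- For `D ≥ 1 / 288` the exponential is at least `exp (-4) ≥ 1 / 81`, and `7 / 81 > 1 / 25`. -/
theorem DensityCondition.lt {D : ℝ} (hD : 0 < D) (h : DensityCondition D) : D < 1 / 288 := by
  by_contra! hD'
  have h1 : Real.exp (-4) ≤ Real.exp (-1 / (72 * D)) := by
    refine Real.exp_le_exp.2 ?_
    rw [le_div_iff₀ (by positivity)]
    linarith
  have h2 : (1 / 81 : ℝ) ≤ Real.exp (-4) := by
    rw [Real.exp_neg, one_div]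
    refine inv_anti₀ (Real.exp_pos _) ?_
    have h3 : Real.exp 4 = Real.exp 1 ^ 4 := by rw [← Real.exp_nat_mul]; norm_num
    rw [h3]
    calc Real.exp 1 ^ 4 ≤ 3 ^ 4 := by gcongr; linarith [Real.exp_one_lt_d9]
      _ = 81 := by norm_num
  rw [DensityCondition] at h
  nlinarith

/-! ### The orthonormal family -/

/-- A row of a matrix close to `1` combines beams of equal `L^p` norm into a function whose norm is
at least three quarters of it. -/
theorem le_normLp_sum_smul {p : ℝ} (hp : 1 ≤ p) {m : ℕ} {F : Matrix (Fin m) (Fin m) ℂ}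
    {q : Fin m → C(S2, ℂ)} {N : ℝ} (hq : ∀ i, normLp p (q i) = N) (i : Fin m)
    (hF : ∑ j, ‖(F - 1) i j‖ ≤ 1 / 4) : 3 / 4 * N ≤ normLp p (∑ j, F i j • q j) := by
  have hN : 0 ≤ N := hq i ▸ normLp_nonneg p (q i)
  have h1 : q i = ∑ j, F i j • q j + ∑ j, (-(F - 1) i j) • q j := by
    ext y
    have h (j : Fin m) : F i j * q j y + -(F - 1) i j * q j y = if i = j then q j y else 0 := by
      rw [Matrix.sub_apply, Matrix.one_apply]
      split_ifs <;> ring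
    simp only [ContinuousMap.add_apply, ContinuousMap.sum_apply, ContinuousMap.smul_apply,
      smul_eq_mul]
    rw [← Finset.sum_add_distrib, Finset.sum_congr rfl fun j _ => h j]
    simp
  have h2 : normLp p (∑ j, (-(F - 1) i j) • q j) ≤ 1 / 4 * N := by
    refine (normLp_sum_le hp _ _).trans ?_
    simp only [normLp_smul, hq, norm_neg]
    rw [← Finset.sum_mul]
    gcongr
  have h3 := normLp_add_le hp (∑ j, F i j • q j) (∑ j, (-(F - 1) i j) • q j)
  rw [← h1, hq] at h3
  linarith

theorem IsGaussianBeam.normLp_eq {k : ℕ} {x : S2} {q : C(S2, ℂ)} (h : IsGaussianBeam k x q)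
    {p : ℝ} (hp : 0 < p) : normLp p q = normLp p (gaussianBeam k) := by
  obtain ⟨R, rfl⟩ := h.exists_eq_compRotate
  exact normLp_compRotate hp _ R

end SphHarm

theorem mainTheorem1 :
    ∃ C : ℝ → ℝ,
      (∀ p : ℝ, 2 < p → p ≤ 6 → 0 < C p ∧
        Tendsto (fun k : ℕ => SphHarm.normLp p (SphHarm.gaussianBeam k) / (k : ℝ) ^ SphHarm.sigma p)
          atTop (𝓝 (C p))) ∧
      SphHarm.DensityCondition (1 / 400) ∧
      ∀ D : ℝ, 0 < D → SphHarm.DensityCondition D →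
        D < 1 ∧
        ∃ k₀ : ℕ, ∀ k : ℕ, k₀ ≤ k → ∀ m : ℕ, m = ⌊D * (2 * (k : ℝ) + 1)⌋₊ →
          ∃ u : Fin m → C(SphHarm.S2, ℂ),
            (∀ i, u i ∈ SphHarm.sphericalHarmonics k) ∧
            (∀ i j, SphHarm.innerL2 (u i) (u j) = if i = j then 1 else 0) ∧
            (∀ i, ∀ p : ℝ, 2 < p → p ≤ 6 →
              (1 / 2) * SphHarm.normLp p (SphHarm.gaussianBeam k) ≤ SphHarm.normLp p (u i) ∧
              (1 / 2) * (C p * (k : ℝ) ^ SphHarm.sigma p) ≤ SphHarm.normLp p (u i)) ∧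
            ∃ (x : Fin m → SphHarm.S2) (q : Fin m → C(SphHarm.S2, ℂ))
              (F : Matrix (Fin m) (Fin m) ℂ),
              (∀ i, SphHarm.IsGaussianBeam k (x i) (q i)) ∧
              (∀ i j, i ≠ j →
                1 / Real.sqrt m ≤ InnerProductGeometry.angle (x i : SphHarm.E3) (x j)) ∧
              SphHarm.IsInvSqrt (SphHarm.gramMatrix q) F ∧
              ∀ i, u i = ∑ j, F i j • q j := by
  open SphHarm in
  refine ⟨beamConst, fun p hp _ => ⟨beamConst_pos (by linarith), tendsto_normLp_gaussianBeam hp⟩,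
    densityCondition_one_div_400, fun D hD0 hD => ?_⟩
  have hD1 := hD.lt hD0
  -- `k ≥ 2` makes `(3 / 4) * k / (k + 1)` at least `1 / 2`, and `k ≥ 9 / D` makes `m` at least `9`
  refine ⟨by linarith, max 2 ⌈9 / D⌉₊, fun k hk m hm => ?_⟩
  have hk2 : 2 ≤ k := le_of_max_le_left hk
  have hk2' : (2 : ℝ) ≤ k := by exact_mod_cast hk2
  have hm9 : 9 ≤ m := by
    have h1 : 9 / D ≤ k := Nat.ceil_le.1 (le_of_max_le_right hk)
    rw [div_le_iff₀ hD0] at h1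
    rw [hm]
    refine Nat.le_floor ?_
    push_cast
    nlinarith
  -- `m ≤ D * (2 * k + 1) ≤ 3 * k / 288`
  have hkm : 20 * m ≤ k := by
    have h1 : (m : ℝ) ≤ D * (2 * (k : ℝ) + 1) := by
      rw [hm]; exact Nat.floor_le (by positivity)
    have h2 : (20 : ℝ) * m ≤ k := by nlinarith
    exact_mod_cast h2
  obtain ⟨x, q, hq, hx, hE⟩ := exists_almost_orthonormal_beams hm9 hkm
  obtain ⟨F, hF, hF1⟩ := exists_isInvSqrt (isHermitian_gramMatrix q) hE
  refine ⟨fun i => ∑ j, F i j • q j,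
    fun i => Submodule.sum_mem _ fun j _ => Submodule.smul_mem _ _ (hq j).mem_sphericalHarmonics,
    innerL2_sum_isInvSqrt hF, fun i p hp _ => ?_, x, q, F, hq, hx, hF, fun i => rfl⟩
  have h1 := le_normLp_sum_smul (by linarith) (fun j => (hq j).normLp_eq (p := p) (by linarith)) i
    (hF1 i)
  have h2 := (normLp_gaussianBeam_bounds hp (k := k) (by lia)).1
  have h3 : (2 / 3 : ℝ) ≤ k / (k + 1) := by
    rw [div_le_div_iff₀ (by norm_num) (by positivity)]; linarith
  have h4 : 0 ≤ beamConst p * (k : ℝ) ^ sigma p := by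
    have := beamConst_pos (p := p) (by linarith)
    positivity
  have h5 := mul_le_mul_of_nonneg_right h3 h4
  have h6 := normLp_nonneg p (gaussianBeam k)
  constructor <;> linarith
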